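/- Let $b\ge 1$ be an integer and $0<\alpha<1$. Let $X_1,X_2,\dots$ be i.i.d. random variables with the Poisson distribution $\mathrm{Po}(\alpha b)$, where $X_i$ is the number of keys with hash address $i$ in linear probing hashing on $\{1,2,3,\dots\}$ with buckets of capacity $b$. Define recursively $Q_0:=0$ and, for $i\ge1$, $$H_i:=X_i+Q_{i-1},\qquad Q_i:=\max(H_i-b,0),\qquad Y_i:=\min(H_i,b),$$ so $H_i$ is the number of keys that try bucket $i$, $Q_i$ is the overflow from bucket $i$, and $Y_i$ is the number of keys finally stored in bucket $i$. Let $B:=\min\{i\ge1: Y_i<b\}$ be the length of the first block. Let $T(z):=\sum_{n\ge1}\frac{n^{n-1}}{n!}z^n$ for $|z|\le e^{-1}$ (the tree function), let $\omega:=e^{2\pi \mathrm{i}/b}$, let $R:=(e^{\alpha-1}/\alpha)^b$, and for $q\in\mathbb C$ with $|q|\le R$ let $$\zeta_\ell(q):=\frac{T\bigl(\omega^\ell\alpha e^{-\alpha}q^{1/b}\bigr)}{\alpha},\qquad \ell=0,\dots,b-1,$$ where $q^{1/b}$ is any choice of a $b$-th root of $q$, the same for all $\ell$. Then $B<\infty$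 almost surely, $R>1$, and for every $q\in\mathbb C$ with $|q|\le R$ the random variable $q^B$ is integrable with $$\mathbb E\,q^B=1-\prod_{\ell=0}^{b-1}\bigl(1-\zeta_\ell(q)\bigr).$$ More generally, for every $q\in\mathbb C$ with $|q|\le R$ and every $t\in\mathbb C$, the random variables $q^Bt^{Y_B}$ and $q^Bt^{H_B}$ are integrable and $$\mathbb E\bigl(q^B t^{Y_B}\bigr)=\mathbb E\bigl(q^B t^{H_B}\bigr)=t^b-\prod_{\ell=0}^{b-1}\bigl(t-\zeta_\ell(q)\bigr).$$ -/

import Mathlib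

namespace PoissonHashing

/-- The overflow `Q_i` from bucket `i` of the one-sided infinite hash table whose buckets
`1, 2, 3, …` have capacity `b`, where `x i` is the number of keys with hash address `i`:
`Q_0 = 0` and `Q_i = (x_i + Q_{i-1} - b)_+`. The natural-number subtraction is the positive part,
and the value `x 0` is never used. -/
def overflow (b : ℕ) (x : ℕ → ℕ) : ℕ → ℕ
  | 0 => 0
  | i + 1 => (x (i + 1) + overflow b x i) - b

/-- The profile: `H_i = x_i + Q_{i-1}` is the number of keys that try bucket `i ≥ 1`.
(There is no bucket `0`; the value there is a dummy.) -/
def profile (b : ℕ) (x : ℕ → ℕ) : ℕ → ℕ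
  | 0 => 0
  | i + 1 => x (i + 1) + overflow b x i

/-- `Y_i = min (H_i, b)`, the final number of keys stored in bucket `i`. -/
def stored (b : ℕ) (x : ℕ → ℕ) (i : ℕ) : ℕ := min (profile b x i) b

/-- `B = min {i ≥ 1 : Y_i < b}`, the length of the first block. (The value is `0` if no bucket is
ever non-full.) -/
noncomputable def blockLength (b : ℕ) (x : ℕ → ℕ) : ℕ :=
  sInf {i : ℕ | 1 ≤ i ∧ stored b x i < b}

/-- The tree function `T(z) = ∑_{n ≥ 1} n^{n-1} z^n / n!`. -/
noncomputable def treeFunction (z : ℂ) : ℂ :=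
  ∑' n : ℕ, ((n + 1 : ℂ) ^ n / ((n + 1).factorial : ℂ)) * z ^ (n + 1)

/-- The series defining the tree function converges absolutely on the closed disc
`|z| ≤ e⁻¹`. -/
theorem summable_treeFunction {z : ℂ} (hz : ‖z‖ ≤ Real.exp (-1)) :
    Summable fun n : ℕ => ((n + 1 : ℂ) ^ n / ((n + 1).factorial : ℂ)) * z ^ (n + 1) := by
  have hs : Summable fun n : ℕ => 1 / ((n + 1 : ℕ) : ℝ) ^ (3 / 2 : ℝ) :=
    (summable_nat_add_iff 1).2 (Real.summable_one_div_nat_rpow.2 (by norm_num))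
  refine Summable.of_norm_bounded hs fun n => ?_
  have hm : (0 : ℝ) < ((n + 1 : ℕ) : ℝ) := by positivity
  have hst := Stirling.le_factorial_stirling (n + 1)
  have hcast : ‖(n + 1 : ℂ)‖ = ((n + 1 : ℕ) : ℝ) := by
    rw [show (n + 1 : ℂ) = ((n + 1 : ℕ) : ℂ) by push_cast; rfl, Complex.norm_natCast]
  rw [norm_mul, norm_div, norm_pow, norm_pow, hcast, Complex.norm_natCast]
  set m : ℝ := ((n + 1 : ℕ) : ℝ) with hmdef
  have hf : (0 : ℝ) < ((n + 1).factorial : ℝ) := by positivity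
  have hzp : ‖z‖ ^ (n + 1) ≤ Real.exp (-1) ^ (n + 1) :=
    pow_le_pow_left₀ (norm_nonneg z) hz _
  have hsq : Real.sqrt m ≤ Real.sqrt (2 * Real.pi * m) :=
    Real.sqrt_le_sqrt (by nlinarith [Real.pi_gt_three])
  have hlow : Real.sqrt m * (m ^ (n + 1) * Real.exp (-1) ^ (n + 1)) ≤
      ((n + 1).factorial : ℝ) := by
    refine le_trans ?_ hst
    rw [← mul_pow, Real.exp_neg, ← div_eq_mul_inv]
    exact mul_le_mul_of_nonneg_right hsq (by positivity)
  have hpow : m ^ (3 / 2 : ℝ) = m * Real.sqrt m := by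
    rw [Real.sqrt_eq_rpow, show (3 / 2 : ℝ) = 1 + 1 / 2 by norm_num, Real.rpow_add hm,
      Real.rpow_one]
  rw [hpow, div_mul_eq_mul_div, div_le_div_iff₀ hf (by positivity), one_mul]
  calc m ^ n * ‖z‖ ^ (n + 1) * (m * Real.sqrt m)
      ≤ m ^ n * Real.exp (-1) ^ (n + 1) * (m * Real.sqrt m) := by gcongr
    _ = Real.sqrt m * (m ^ (n + 1) * Real.exp (-1) ^ (n + 1)) := by ring
    _ ≤ _ := hlow

/-- `ζ_ℓ = T(ω^ℓ α e^{-α} r) / α` with `ω = e^{2πi/b}`; here `r` is the chosen `b`-th root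
`q^{1/b}` of `q`. -/
noncomputable def zeta (α : ℝ) (b : ℕ) (r : ℂ) (l : ℕ) : ℂ :=
  treeFunction (Complex.exp (2 * Real.pi * Complex.I / b) ^ l * (α * Complex.exp (-α)) * r) / α

/-- The radius `R = (e^{α-1} / α)^b`; the condition `|q| ≤ R` says exactly that
`|α e^{-α} q^{1/b}| ≤ e⁻¹`. -/
noncomputable def radius (α : ℝ) (b : ℕ) : ℝ := (Real.exp (α - 1) / α) ^ b

/-- For `|q| ≤ R`, each `ζ_ℓ(q)` is the value of the tree function at a point of the closed disc
on which its series converges. -/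
theorem norm_zeta_arg_le {α : ℝ} (hα : 0 < α) {b : ℕ} (hb : 1 ≤ b) {q r : ℂ}
    (hq : ‖q‖ ≤ radius α b) (hr : r ^ b = q) (l : ℕ) :
    ‖Complex.exp (2 * Real.pi * Complex.I / b) ^ l * (α * Complex.exp (-α)) * r‖
      ≤ Real.exp (-1) := by
  have h1 : ‖r‖ ≤ Real.exp (α - 1) / α := by
    rw [← hr, norm_pow, radius] at hq
    exact le_of_pow_le_pow_left₀ (by omega) (by positivity) hq
  have h2 : ‖Complex.exp (2 * Real.pi * Complex.I / b)‖ = 1 := by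
    rw [show (2 * Real.pi * Complex.I / b : ℂ) = ((2 * Real.pi / b : ℝ) : ℂ) * Complex.I by
      push_cast; ring]
    exact Complex.norm_exp_ofReal_mul_I _
  have h3 : ‖(α * Complex.exp (-α) : ℂ)‖ = α * Real.exp (-α) := by
    rw [norm_mul, Complex.norm_real, Real.norm_of_nonneg hα.le, Complex.norm_exp]
    simp
  rw [norm_mul, norm_mul, norm_pow, h2, one_pow, one_mul, h3]
  calc α * Real.exp (-α) * ‖r‖ ≤ α * Real.exp (-α) * (Real.exp (α - 1) / α) := by gcongr
    _ = Real.exp (-α) * Real.exp (α - 1) := by field_simp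
    _ = Real.exp (-1) := by rw [← Real.exp_add]; congr 1; ring

end PoissonHashing

/-! If `q * exp (α b (z - 1)) = z ^ b`, then `q ^ n * z ^ Q_n`, followed up to the block end `B`, is
a martingale: `X_{n+1}` is independent of the past, and a full bucket turns `H` into `Q = H - b`.
Stopping at `min B n` is `sum_pow_mul_setIntegral_exit`; stopping at `B` itself gives `E (q ^ B * z
^ H_B) = z ^ b`.

Since `H_B < b`, the map `t ↦ E (q ^ B * t ^ H_B)` is a polynomial of degree below `b`. Subtracting
it from `t ^ b` leaves a monic polynomial of degree `b` that vanishes at every admissible `z`. The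
functional equation `T e^{-T} = z` makes each `ζ_ℓ` admissible, `|T| ≤ 1` gives `|ζ_ℓ| ≤ 1/α`, and
for `q ≠ 0` the `b` values are distinct; this determines the polynomial (`pow_sub_sum_eq_prod`).

All analytic control comes from the admissible pair `q = R`, `z = 1/α`. There every term is
nonnegative, so the identity at finite `n` already yields tail bounds, hence `B < ∞` almost surely,
integrability for `|q| ≤ R`, and a vanishing remainder for `|q| < R`. The circle `|q| = R` follows
by radial continuity. -/

namespace PoissonHashing

/-! ### The tree function: functional equation and the bound `|T| ≤ 1`. -/

open Filter Topology

/-- The coefficient of `w ^ (m + 1)` in the expansion of `T(w e^{-w})`. -/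
theorem sum_antidiagonal_treeFunction_coeff (m : ℕ) :
    ∑ p ∈ Finset.HasAntidiagonal.antidiagonal m, ((p.1 + 1 : ℂ) ^ p.1 / ((p.1 + 1).factorial : ℂ)) *
      ((-(p.1 + 1 : ℂ)) ^ p.2 / (p.2.factorial : ℂ)) = if m = 0 then 1 else 0 := by
  rcases Nat.eq_zero_or_pos m with rfl | hm
  · simp
  rw [if_neg hm.ne']
  -- Multiplied by `(m+1)!`, the sum is the `(m+1)`-st forward difference of `x ^ m` at `0`, whose
  -- term at `x = 0` vanishes because `m > 0`.
  have h := congrFun (fwdDiff_iter_pow_eq_zero_of_lt (R := ℂ) (Nat.lt_succ_self m)) 0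
  rw [fwdDiff_iter_eq_sum_shift, Finset.sum_range_succ'] at h
  simp only [Nat.succ_eq_add_one, zsmul_eq_mul, zero_add, nsmul_eq_mul, mul_one, Pi.zero_apply,
    zero_smul, zero_pow hm.ne', mul_zero, add_zero] at h
  rw [Finset.Nat.sum_antidiagonal_eq_sum_range_succ_mk]
  have hf : ((m + 1).factorial : ℂ) ≠ 0 := by exact_mod_cast Nat.factorial_ne_zero _
  rw [← mul_right_inj' hf, mul_zero, ← h, Finset.mul_sum]
  refine Finset.sum_congr rfl fun p hp => ?_
  have hpm : p ≤ m := by simpa [Nat.lt_succ_iff] using hp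
  have hch := Nat.choose_mul_factorial_mul_factorial (Nat.succ_le_succ hpm)
  have hsub : m + 1 - (p + 1) = m - p := by omega
  simp only [Nat.succ_eq_add_one, hsub] at hch ⊢
  have h1 : ((p + 1).factorial : ℂ) ≠ 0 := by exact_mod_cast Nat.factorial_ne_zero _
  have h2 : ((m - p).factorial : ℂ) ≠ 0 := by exact_mod_cast Nat.factorial_ne_zero _
  rw [← hch, neg_pow]
  have h3 : (p + 1 : ℂ) ^ m = (p + 1 : ℂ) ^ p * (p + 1 : ℂ) ^ (m - p) := by
    rw [← pow_add]; congr 1; omega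
  push_cast
  rw [h3]
  field_simp

theorem treeFunction_term_norm (n : ℕ) (z : ℂ) :
    ‖((n + 1 : ℂ) ^ n / ((n + 1).factorial : ℂ)) * z ^ (n + 1)‖ =
      ((n + 1 : ℝ) ^ n / ((n + 1).factorial : ℝ)) * ‖z‖ ^ (n + 1) := by
  have hcast : ‖(n + 1 : ℂ)‖ = (n + 1 : ℝ) := by
    rw [show (n + 1 : ℂ) = ((n + 1 : ℕ) : ℂ) by push_cast; rfl, Complex.norm_natCast]
    push_cast; rfl
  rw [norm_mul, norm_div, norm_pow, norm_pow, hcast, Complex.norm_natCast]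

theorem summable_treeFunction_real {x : ℝ} (h0 : 0 ≤ x) (hx : x ≤ Real.exp (-1)) :
    Summable fun n : ℕ => ((n + 1 : ℝ) ^ n / ((n + 1).factorial : ℝ)) * x ^ (n + 1) := by
  have h := (summable_treeFunction (z := (x : ℂ)) (by simpa [abs_of_nonneg h0] using hx)).norm
  simp_rw [treeFunction_term_norm] at h
  simpa [abs_of_nonneg h0] using h

theorem treeFunction_term_norm_le (n : ℕ) {z : ℂ} {x : ℝ} (hz : ‖z‖ ≤ x) :
    ‖((n + 1 : ℂ) ^ n / ((n + 1).factorial : ℂ)) * z ^ (n + 1)‖ ≤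
      ((n + 1 : ℝ) ^ n / ((n + 1).factorial : ℝ)) * x ^ (n + 1) := by
  rw [treeFunction_term_norm]
  gcongr

/-- `T` inverts `w ↦ w e^{-w}` near the origin. -/
theorem treeFunction_mul_exp_neg {w : ℂ} (hw : ‖w‖ * Real.exp ‖w‖ ≤ Real.exp (-1)) :
    treeFunction (w * Complex.exp (-w)) = w := by
  let f : ℕ × ℕ → ℂ := fun p => (((p.1 + 1 : ℂ) ^ p.1 / ((p.1 + 1).factorial : ℂ)) *
      ((-(p.1 + 1 : ℂ)) ^ p.2 / (p.2.factorial : ℂ))) * w ^ (p.1 + p.2 + 1)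
  have hf : ∀ p k, f (p, k) = (((p + 1 : ℂ) ^ p / ((p + 1).factorial : ℂ)) * w ^ (p + 1)) *
      ((-(p + 1 : ℂ) * w) ^ k / (k.factorial : ℂ)) := by
    intro p k
    simp only [f, mul_pow, pow_add]
    ring
  have hexp : ∀ z : ℂ, HasSum (fun k : ℕ => z ^ k / (k.factorial : ℂ)) (Complex.exp z) := by
    intro z
    rw [Complex.exp_eq_exp_ℂ]
    exact NormedSpace.expSeries_div_hasSum_exp z
  have hin : ∀ p : ℕ, HasSum (fun k => f (p, k))
      (((p + 1 : ℂ) ^ p / ((p + 1).factorial : ℂ)) * (w * Complex.exp (-w)) ^ (p + 1)) := by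
    intro p
    simp_rw [hf]
    convert! (hexp (-(p + 1 : ℂ) * w)).mul_left _ using 1
    rw [mul_pow, ← Complex.exp_nat_mul, mul_assoc]
    congr 3
    push_cast; ring
  have hnorm : ∀ p : ℕ, HasSum (fun k => ‖f (p, k)‖)
      (((p + 1 : ℝ) ^ p / ((p + 1).factorial : ℝ)) * (‖w‖ * Real.exp ‖w‖) ^ (p + 1)) := by
    intro p
    simp_rw [hf]
    have h1 : HasSum (fun k : ℕ => ((p + 1 : ℝ) * ‖w‖) ^ k / (k.factorial : ℝ))
        (Real.exp ((p + 1 : ℝ) * ‖w‖)) := by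
      rw [Real.exp_eq_exp_ℝ]
      exact NormedSpace.expSeries_div_hasSum_exp _
    have hcast : ‖(p + 1 : ℂ)‖ = (p + 1 : ℝ) := by
      rw [show (p + 1 : ℂ) = ((p + 1 : ℕ) : ℂ) by push_cast; rfl, Complex.norm_natCast]
      push_cast; rfl
    convert! h1.mul_left ((p + 1 : ℝ) ^ p / ((p + 1).factorial : ℝ) * ‖w‖ ^ (p + 1)) using 1
    · funext k
      rw [norm_mul, treeFunction_term_norm, norm_div, norm_pow, norm_mul, norm_neg, hcast,
        Complex.norm_natCast]
    · rw [mul_pow, ← Real.exp_nat_mul, mul_assoc]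
      push_cast; rfl
  -- Taking norms turns `e^{-w}` into `e^{‖w‖}`, so absolute convergence is that of the tree series
  -- at `‖w‖ e^{‖w‖}`. It permits regrouping the double series by powers of `w`.
  have hs : Summable f := by
    refine Summable.of_norm ((summable_prod_of_nonneg fun _ => norm_nonneg _).2
      ⟨fun p => (hnorm p).summable, ?_⟩)
    simp_rw [fun p => (hnorm p).tsum_eq]
    exact summable_treeFunction_real (by positivity) hw
  have h1 : treeFunction (w * Complex.exp (-w)) = ∑' p, f p := by
    rw [hs.tsum_prod' fun p => (hin p).summable, treeFunction]
    exact tsum_congr fun p => (hin p).tsum_eq.symm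
  have h2 := Summable.tsum_sigma' (f := fun c => f (Finset.HasAntidiagonal.sigmaAntidiagonalEquivProd c))
    (fun n => (hasSum_fintype _).summable)
    (Finset.HasAntidiagonal.sigmaAntidiagonalEquivProd.summable_iff.2 hs)
  rw [h1, ← Finset.HasAntidiagonal.sigmaAntidiagonalEquivProd.tsum_eq f, h2]
  have hdiag : ∀ m : ℕ, ∑' c : Finset.HasAntidiagonal.antidiagonal m,
      f (Finset.HasAntidiagonal.sigmaAntidiagonalEquivProd ⟨m, c⟩) = (if m = 0 then 1 else 0) * w ^ (m + 1) := by
    intro m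
    rw [tsum_fintype, ← sum_antidiagonal_treeFunction_coeff, Finset.sum_mul,
      ← Finset.sum_coe_sort (Finset.HasAntidiagonal.antidiagonal m)]
    refine Finset.sum_congr rfl fun c _ => ?_
    have hc := Finset.HasAntidiagonal.mem_antidiagonal.1 c.2
    simp only [Finset.HasAntidiagonal.sigmaAntidiagonalEquivProd_apply, f, hc]
  rw [tsum_congr hdiag, tsum_eq_single 0 (by intro m hm; simp [hm])]
  simp

theorem continuousOn_treeFunction :
    ContinuousOn treeFunction (Metric.closedBall 0 (Real.exp (-1))) := by
  refine continuousOn_tsum (fun n => by fun_prop)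
    (summable_treeFunction_real (Real.exp_pos (-1)).le le_rfl) fun n z hz =>
    treeFunction_term_norm_le n (by simpa using hz)

theorem analyticOnNhd_treeFunction :
    AnalyticOnNhd ℂ treeFunction (Metric.ball 0 (Real.exp (-1))) := by
  refine DifferentiableOn.analyticOnNhd ?_ Metric.isOpen_ball
  refine Complex.differentiableOn_tsum_of_summable_norm
    (summable_treeFunction_real (Real.exp_pos (-1)).le le_rfl) (fun n => by fun_prop)
    Metric.isOpen_ball fun n z hz => treeFunction_term_norm_le n ?_
  simpa using (Metric.mem_ball.1 hz).le

theorem treeFunction_zero : treeFunction 0 = 0 := by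
  simp [treeFunction]

/-- The map `w ↦ w e^{-w}` has derivative `1` at `0`, so it carries the neighbourhood filter of `0`
onto itself: every `z` near `0` is `w e^{-w}` with `w` small, and there `T(z) = w`. -/
theorem treeFunction_mul_exp_neg_self_nhds_zero :
    ∀ᶠ z in 𝓝 (0 : ℂ), treeFunction z * Complex.exp (-treeFunction z) = z := by
  have hd : HasStrictDerivAt (fun w : ℂ => w * Complex.exp (-w)) 1 0 := by
    have h := (hasStrictDerivAt_id (0 : ℂ)).mul (hasStrictDerivAt_id (0 : ℂ)).neg.cexp
    simpa using! h
  have hmap := hd.map_nhds_eq one_ne_zero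
  rw [zero_mul] at hmap
  rw [← hmap, eventually_map]
  have hc : ContinuousAt (fun w : ℂ => ‖w‖ * Real.exp ‖w‖) 0 := by fun_prop
  have := hc.eventually (eventually_lt_nhds (b := Real.exp (-1)) (by simp [Real.exp_pos]))
  filter_upwards [this] with w hw
  rw [treeFunction_mul_exp_neg hw.le]

/-- The functional equation `T(z) e^{-T(z)} = z` on the closed disc of convergence. -/
theorem treeFunction_mul_exp_neg_self {z : ℂ} (hz : ‖z‖ ≤ Real.exp (-1)) :
    treeFunction z * Complex.exp (-treeFunction z) = z := by
  have han := analyticOnNhd_treeFunction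
  -- The identity theorem spreads the local equation over the open disc; continuity then carries it
  -- to the boundary circle.
  have hball : Set.EqOn (fun z => treeFunction z * Complex.exp (-treeFunction z)) id
      (Metric.ball 0 (Real.exp (-1))) :=
    (han.mul han.neg.cexp).eqOn_of_preconnected_of_eventuallyEq analyticOnNhd_id
      (convex_ball _ _).isPreconnected (Metric.mem_ball_self (Real.exp_pos _))
      treeFunction_mul_exp_neg_self_nhds_zero
  have hc := continuousOn_treeFunction
  have hcl := hball.of_subset_closure (t := Metric.closedBall 0 (Real.exp (-1)))
    (hc.mul hc.neg.cexp) continuousOn_id Metric.ball_subset_closedBall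
    (by rw [closure_ball _ (Real.exp_pos _).ne'])
  exact hcl (by simpa using hz)

theorem treeFunction_ofReal (x : ℝ) : treeFunction x = ((treeFunction x).re : ℂ) := by
  have : treeFunction x = ((∑' n : ℕ, ((n + 1 : ℝ) ^ n / ((n + 1).factorial : ℝ)) *
      x ^ (n + 1) : ℝ) : ℂ) := by
    rw [treeFunction, Complex.ofReal_tsum]
    push_cast; rfl
  rw [this, Complex.ofReal_re]

/-- Otherwise `T` takes the value `1` at some `x` in `[0, e⁻¹]`. The functional equation forces `x =
e⁻¹`, so `T(e⁻¹) = 1` after all. -/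
theorem re_treeFunction_exp_neg_one_le : (treeFunction (Real.exp (-1) : ℝ)).re ≤ 1 := by
  by_contra! h
  have hcont : ContinuousOn (fun x : ℝ => (treeFunction x).re) (Set.Icc 0 (Real.exp (-1))) := by
    refine Complex.continuous_re.comp_continuousOn (continuousOn_treeFunction.comp
      Complex.continuous_ofReal.continuousOn fun x hx => ?_)
    simpa [abs_of_nonneg hx.1] using hx.2
  obtain ⟨x, hx, hx1⟩ := intermediate_value_Icc (Real.exp_pos (-1)).le hcont
    (show (1 : ℝ) ∈ _ by constructor <;> simp [treeFunction_zero]; simpa using h.le)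
  have hfx := treeFunction_mul_exp_neg_self (z := (x : ℂ))
    (by simpa [abs_of_nonneg hx.1] using hx.2)
  simp only at hx1
  rw [treeFunction_ofReal, hx1] at hfx
  have : x = Real.exp (-1) := by
    have := congrArg Complex.re hfx.symm
    simpa [← Complex.ofReal_one, ← Complex.ofReal_neg, ← Complex.ofReal_exp] using this
  rw [← this, hx1] at h
  exact lt_irrefl _ h

/-- The coefficients are nonnegative, so the value at `e⁻¹` dominates. -/
theorem norm_treeFunction_le_one {z : ℂ} (hz : ‖z‖ ≤ Real.exp (-1)) : ‖treeFunction z‖ ≤ 1 := by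
  refine le_trans ?_ re_treeFunction_exp_neg_one_le
  have hs := summable_treeFunction_real (Real.exp_pos (-1)).le le_rfl
  have : (treeFunction (Real.exp (-1) : ℝ)).re =
      ∑' n : ℕ, ((n + 1 : ℝ) ^ n / ((n + 1).factorial : ℝ)) * Real.exp (-1) ^ (n + 1) := by
    rw [← Complex.ofReal_inj, ← treeFunction_ofReal, treeFunction, Complex.ofReal_tsum]
    push_cast; rfl
  rw [this]
  exact tsum_of_norm_bounded hs.hasSum fun n => treeFunction_term_norm_le n hz

end PoissonHashing

namespace PoissonHashing

/-! ### The overflow process and optional stopping at a bounded time. -/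

open MeasureTheory ProbabilityTheory Filter Topology

/-- Dependence on the loads `1, …, n` alone is what makes the past independent of load `n + 1`. -/
theorem overflow_congr {b : ℕ} {x y : ℕ → ℕ} {n : ℕ} (h : ∀ i < n, x (i + 1) = y (i + 1)) :
    overflow b x n = overflow b y n := by
  induction n with
  | zero => rfl
  | succ n ih =>
    simp only [overflow]
    rw [h n n.lt_succ_self, ih fun i hi => h i (hi.trans n.lt_succ_self)]

theorem profile_congr {b : ℕ} {x y : ℕ → ℕ} {n : ℕ} (h : ∀ i < n, x (i + 1) = y (i + 1)) :
    profile b x n = profile b y n := by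
  cases n with
  | zero => rfl
  | succ n =>
    simp only [profile]
    rw [h n n.lt_succ_self, overflow_congr fun i hi => h i (hi.trans n.lt_succ_self)]

theorem overflow_succ_eq (b : ℕ) (x : ℕ → ℕ) (n : ℕ) :
    overflow b x (n + 1) = profile b x (n + 1) - b := rfl

/-- The load sequences for which buckets `1, …, n` are all full. -/
def fullSeq (b n : ℕ) : Set (ℕ → ℕ) := {x | ∀ i < n, b ≤ profile b x (i + 1)}

/-- The load sequences for which bucket `n + 1` is the first bucket that is not full. -/
def exitSeq (b n : ℕ) : Set (ℕ → ℕ) := {x | x ∈ fullSeq b n ∧ profile b x (n + 1) < b}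

theorem mem_fullSeq_congr {b : ℕ} {x y : ℕ → ℕ} {n : ℕ} (h : ∀ i < n, x (i + 1) = y (i + 1)) :
    x ∈ fullSeq b n ↔ y ∈ fullSeq b n := by
  refine forall₂_congr fun i hi => ?_
  rw [profile_congr fun j hj => h j (by omega)]

theorem mem_fullSeq_succ {b n : ℕ} {x : ℕ → ℕ} :
    x ∈ fullSeq b (n + 1) ↔ x ∈ fullSeq b n ∧ b ≤ profile b x (n + 1) := by
  simp only [fullSeq, Set.mem_ofPred_eq]
  constructor
  · exact fun h => ⟨fun i hi => h i (by omega), h n n.lt_succ_self⟩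
  · rintro ⟨h1, h2⟩ i hi
    rcases Nat.lt_succ_iff_lt_or_eq.1 hi with hi | rfl
    exacts [h1 i hi, h2]

theorem stored_lt_iff {b : ℕ} {x : ℕ → ℕ} {i : ℕ} : stored b x i < b ↔ profile b x i < b := by
  simp [stored]

theorem blockLength_eq_of_mem_exitSeq {b n : ℕ} {x : ℕ → ℕ} (h : x ∈ exitSeq b n) :
    blockLength b x = n + 1 := by
  refine IsLeast.csInf_eq ⟨⟨by omega, stored_lt_iff.2 h.2⟩, ?_⟩
  rintro i ⟨hi, hi'⟩
  rw [stored_lt_iff] at hi'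
  by_contra! hlt
  have := h.1 (i - 1) (by omega)
  rw [Nat.sub_add_cancel hi] at this
  omega

theorem exists_mem_exitSeq {b i : ℕ} {x : ℕ → ℕ} (hi : profile b x (i + 1) < b) :
    ∃ n, x ∈ exitSeq b n := by
  classical
  have hex : ∃ n, profile b x (n + 1) < b := ⟨i, hi⟩
  exact ⟨Nat.find hex, fun j hj => not_lt.1 (Nat.find_min hex hj), Nat.find_spec hex⟩

/-- The loads of buckets `1, 2, 3, …` are independent and have the law `Po(α b)`. -/
structure IsPoissonTable {Ω : Type*} [MeasurableSpace Ω] (μ : Measure Ω) (α : ℝ) (b : ℕ)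
    (X : ℕ → Ω → ℕ) : Prop where
  measurable : ∀ i, Measurable (X (i + 1))
  law : ∀ i, Measure.map (X (i + 1)) μ = poissonMeasure (Real.toNNReal (α * b))
  indep : iIndepFun (fun i : ℕ => X (i + 1)) μ

theorem hasSum_poisson_pow (r : NNReal) (z : ℂ) :
    HasSum (fun n : ℕ => (Real.exp (-r) * r ^ n / (n.factorial : ℝ)) • z ^ n)
      (Complex.exp (r * (z - 1))) := by
  have h : HasSum (fun k : ℕ => (r * z) ^ k / (k.factorial : ℂ)) (Complex.exp (r * z)) := by
    rw [Complex.exp_eq_exp_ℂ]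
    exact NormedSpace.expSeries_div_hasSum_exp _
  convert! h.mul_left (Complex.exp (-r)) using 1
  · funext n
    rw [Complex.real_smul]
    push_cast
    ring
  · rw [← Complex.exp_add]
    ring_nf

theorem integrable_pow_poissonMeasure (r : NNReal) (z : ℂ) :
    Integrable (fun n : ℕ => z ^ n) (poissonMeasure r) := by
  rw [integrable_poissonMeasure_iff]
  refine (hasSum_poisson_pow r (‖z‖ : ℂ)).summable.norm.congr fun n => ?_
  rw [norm_smul, Real.norm_of_nonneg (by positivity)]
  simp

theorem integral_pow_poissonMeasure (r : NNReal) (z : ℂ) :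
    ∫ n : ℕ, z ^ n ∂poissonMeasure r = Complex.exp (r * (z - 1)) := by
  rw [integral_poissonMeasure, (hasSum_poisson_pow r z).tsum_eq]

namespace IsPoissonTable

variable {Ω : Type*} [MeasurableSpace Ω] {μ : Measure Ω} {α : ℝ} {b : ℕ} {X : ℕ → Ω → ℕ}

theorem measurable_overflow (h : IsPoissonTable μ α b X) (n : ℕ) :
    Measurable fun ω => overflow b (X · ω) n := by
  induction n with
  | zero => exact measurable_const
  | succ n ih => exact ((h.measurable n).add ih).sub_const b

theorem measurable_profile (h : IsPoissonTable μ α b X) (n : ℕ) :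
    Measurable fun ω => profile b (X · ω) n := by
  cases n with
  | zero => exact measurable_const
  | succ n => exact (h.measurable n).add (h.measurable_overflow n)

theorem measurableSet_full (h : IsPoissonTable μ α b X) (n : ℕ) :
    MeasurableSet {ω | (X · ω) ∈ fullSeq b n} := by
  have : {ω | (X · ω) ∈ fullSeq b n} =
      ⋂ i : ℕ, ⋂ _ : i < n, {ω | b ≤ profile b (X · ω) (i + 1)} := by
    ext ω
    simp [fullSeq]
  rw [this]
  exact MeasurableSet.iInter fun i => MeasurableSet.iInter fun _ =>
    measurableSet_le measurable_const (h.measurable_profile (i + 1))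

theorem measurableSet_exit (h : IsPoissonTable μ α b X) (n : ℕ) :
    MeasurableSet {ω | (X · ω) ∈ exitSeq b n} :=
  (h.measurableSet_full n).inter
    (measurableSet_lt (h.measurable_profile (n + 1)) measurable_const)

/-- A statistic of the first `n` loads is independent of load `n + 1`. -/
theorem indepFun_of_congr (h : IsPoissonTable μ α b X) {n : ℕ} {F : (ℕ → ℕ) → ℂ}
    (hF : ∀ x y : ℕ → ℕ, (∀ i < n, x (i + 1) = y (i + 1)) → F x = F y) :
    IndepFun (X (n + 1)) (fun ω => F (X · ω)) μ := by
  have hi := h.indep.indepFun_finset {n} (Finset.range n) (by simp) h.measurable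
  have hi' := hi.comp (φ := fun y => y ⟨n, Finset.mem_singleton_self n⟩)
    -- Rebuilds a load sequence from the first `n` loads; `hF` makes the filler `0` and the dummy
    -- entry at index `0` irrelevant.
    (ψ := fun y => F fun j => if hj : j - 1 ∈ Finset.range n then y ⟨j - 1, hj⟩ else 0)
    Measurable.of_discrete Measurable.of_discrete
  convert! hi' using 1
  funext ω
  refine hF _ _ fun i hi => ?_
  simp [hi]

theorem integrable_pow_load (h : IsPoissonTable μ α b X) (n : ℕ) (z : ℂ) :
    Integrable (fun ω => z ^ X (n + 1) ω) μ := by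
  have := integrable_pow_poissonMeasure (Real.toNNReal (α * b)) z
  rw [← h.law n] at this
  exact this.comp_measurable (h.measurable n)

theorem integral_pow_load (h : IsPoissonTable μ α b X) (hα : 0 < α) (n : ℕ) (z : ℂ) :
    ∫ ω, z ^ X (n + 1) ω ∂μ = Complex.exp (α * b * (z - 1)) := by
  have := integral_pow_poissonMeasure (Real.toNNReal (α * b)) z
  rw [← h.law n, integral_map (h.measurable n).aemeasurable
    (Measurable.of_discrete).aestronglyMeasurable] at this
  rw [this, Real.coe_toNNReal _ (by positivity)]
  push_cast; rfl

theorem integrable_pow_overflow [IsProbabilityMeasure μ] (h : IsPoissonTable μ α b X) (n : ℕ)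
    (z : ℂ) : Integrable (fun ω => z ^ overflow b (X · ω) n) μ := by
  -- A base at least `1` makes powers monotone, so `Q_{n+1} ≤ X_{n+1} + Q_n` bounds the next power
  -- by a product of independent factors. A general `z` is dominated by `max 1 ‖z‖`.
  have key : ∀ s : ℝ, 1 ≤ s → Integrable (fun ω => (s : ℂ) ^ overflow b (X · ω) n) μ := by
    intro s hs
    induction n with
    | zero => simp [overflow]
    | succ n ih =>
      have hind := h.indepFun_of_congr (n := n) (F := fun x => (s : ℂ) ^ overflow b x n)
        fun x y hxy => by rw [overflow_congr hxy]
      have hmul := IndepFun.integrable_mul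
        (hind.comp (φ := fun k => (s : ℂ) ^ k) (ψ := id) Measurable.of_discrete measurable_id)
        (h.integrable_pow_load n s) ih
      refine hmul.mono ((Measurable.of_discrete (f := fun k : ℕ => (s : ℂ) ^ k)).comp
        (h.measurable_overflow (n + 1))).aestronglyMeasurable (ae_of_all _ fun ω => ?_)
      simp only [Pi.mul_apply, Function.comp_apply, id_eq, ← pow_add, norm_pow,
        Complex.norm_real, Real.norm_of_nonneg (zero_le_one.trans hs)]
      exact pow_le_pow_right₀ hs (Nat.sub_le _ _)
  refine (key (max 1 ‖z‖) (le_max_left _ _)).mono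
    ((Measurable.of_discrete (f := fun k : ℕ => z ^ k)).comp
      (h.measurable_overflow n)).aestronglyMeasurable (ae_of_all _ fun ω => ?_)
  rw [norm_pow, norm_pow, Complex.norm_real, Real.norm_of_nonneg (by positivity)]
  gcongr
  exact le_max_right _ _

theorem integrable_pow_profile [IsProbabilityMeasure μ] (h : IsPoissonTable μ α b X) (n : ℕ)
    (z : ℂ) : Integrable (fun ω => z ^ profile b (X · ω) (n + 1)) μ := by
  have hind := h.indepFun_of_congr (n := n) (F := fun x => z ^ overflow b x n)
    fun x y hxy => by rw [overflow_congr hxy]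
  have hmul := IndepFun.integrable_mul
    (hind.comp (φ := fun k => z ^ k) (ψ := id) Measurable.of_discrete measurable_id)
    (h.integrable_pow_load n z) (h.integrable_pow_overflow n z)
  refine hmul.congr (ae_of_all _ fun ω => ?_)
  simp [profile, pow_add]

/-- `E(z ^ H_{n+1}; B > n) = E z ^ X_{n+1} · E(z ^ Q_n; B > n)`. -/
theorem setIntegral_pow_profile (h : IsPoissonTable μ α b X) (hα : 0 < α) (n : ℕ) (z : ℂ) :
    ∫ ω in {ω | (X · ω) ∈ fullSeq b n}, z ^ profile b (X · ω) (n + 1) ∂μ =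
      Complex.exp (α * b * (z - 1)) *
        ∫ ω in {ω | (X · ω) ∈ fullSeq b n}, z ^ overflow b (X · ω) n ∂μ := by
  have hind := h.indepFun_of_congr (n := n)
    (F := (fullSeq b n).indicator fun x => z ^ overflow b x n) fun x y hxy => by
      by_cases hx : x ∈ fullSeq b n
      · rw [Set.indicator_of_mem hx, Set.indicator_of_mem ((mem_fullSeq_congr hxy).1 hx),
          overflow_congr hxy]
      · rw [Set.indicator_of_notMem hx, Set.indicator_of_notMem (mt (mem_fullSeq_congr hxy).2 hx)]
  have hmeas : Measurable fun ω => (fullSeq b n).indicator (fun x => z ^ overflow b x n) (X · ω) :=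
    ((Measurable.of_discrete (f := fun k : ℕ => z ^ k)).comp
      (h.measurable_overflow n)).indicator (h.measurableSet_full n)
  have hmul := IndepFun.integral_fun_comp_mul_comp (f := fun k : ℕ => z ^ k) (g := id) hind
    (h.measurable n).aemeasurable hmeas.aemeasurable
    Measurable.of_discrete.aestronglyMeasurable measurable_id.aestronglyMeasurable
  rw [h.integral_pow_load hα] at hmul
  rw [← integral_indicator (h.measurableSet_full n), ← integral_indicator (h.measurableSet_full n)]
  convert! hmul using 1
  refine integral_congr_ae (ae_of_all _ fun ω => ?_)
  by_cases hx : (X · ω) ∈ fullSeq b n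
  · simp [Set.indicator, hx, profile, pow_add]
  · simp [Set.indicator, hx]

/-- Splitting `E(z ^ H_{n+1}; B > n)` according to whether bucket `n + 1` is full. -/
theorem exp_mul_setIntegral_pow_overflow [IsProbabilityMeasure μ] (h : IsPoissonTable μ α b X)
    (hα : 0 < α) (n : ℕ) (z : ℂ) :
    Complex.exp (α * b * (z - 1)) *
        ∫ ω in {ω | (X · ω) ∈ fullSeq b n}, z ^ overflow b (X · ω) n ∂μ =
      ∫ ω in {ω | (X · ω) ∈ exitSeq b n}, z ^ profile b (X · ω) (n + 1) ∂μ +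
      z ^ b * ∫ ω in {ω | (X · ω) ∈ fullSeq b (n + 1)}, z ^ overflow b (X · ω) (n + 1) ∂μ := by
  have hset : {ω | (X · ω) ∈ fullSeq b n} =
      {ω | (X · ω) ∈ exitSeq b n} ∪ {ω | (X · ω) ∈ fullSeq b (n + 1)} := by
    ext ω
    simp only [Set.mem_ofPred_eq, Set.mem_union, exitSeq, mem_fullSeq_succ, ← and_or_left]
    simp [lt_or_ge]
  have hdisj : Disjoint {ω | (X · ω) ∈ exitSeq b n} {ω | (X · ω) ∈ fullSeq b (n + 1)} := by
    rw [Set.disjoint_left]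
    intro ω h1 h2
    exact absurd (mem_fullSeq_succ.1 h2).2 (not_le.2 h1.2)
  rw [← h.setIntegral_pow_profile hα, hset, setIntegral_union hdisj (h.measurableSet_full (n + 1))
    (h.integrable_pow_profile n z).integrableOn (h.integrable_pow_profile n z).integrableOn,
    ← integral_const_mul]
  congr 1
  refine setIntegral_congr_fun (h.measurableSet_full (n + 1)) fun ω hω => ?_
  have := (mem_fullSeq_succ.1 hω).2
  simp only [overflow_succ_eq, ← pow_add]
  congr 1
  omega

/-- The optional stopping identity at the time `min B n`. -/
theorem sum_pow_mul_setIntegral_exit [IsProbabilityMeasure μ] (h : IsPoissonTable μ α b X)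
    (hα : 0 < α) {q z : ℂ} (hqz : q * Complex.exp (α * b * (z - 1)) = z ^ b) (n : ℕ) :
    ∑ k ∈ Finset.range n, q ^ (k + 1) *
        ∫ ω in {ω | (X · ω) ∈ exitSeq b k}, z ^ profile b (X · ω) (k + 1) ∂μ =
      z ^ b * (1 - q ^ n *
        ∫ ω in {ω | (X · ω) ∈ fullSeq b n}, z ^ overflow b (X · ω) n ∂μ) := by
  induction n with
  | zero => simp [fullSeq, overflow]
  | succ n ih =>
    rw [Finset.sum_range_succ, ih]
    have := h.exp_mul_setIntegral_pow_overflow hα n z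
    -- The relation `hqz` trades `q * exp (α b (z - 1))` for `z ^ b`, so the old remainder cancels.
    linear_combination (-q ^ (n + 1)) * this + (q ^ n *
      ∫ ω in {ω | (X · ω) ∈ fullSeq b n}, z ^ overflow b (X · ω) n ∂μ) * hqz

end IsPoissonTable
end PoissonHashing

namespace PoissonHashing

/-! ### Tail bounds from the pair `(R, 1/α)` and optional stopping at `B`. -/

open MeasureTheory ProbabilityTheory Filter Topology

theorem one_lt_exp_sub_one_div {α : ℝ} (hα0 : 0 < α) (hα1 : α < 1) :
    1 < Real.exp (α - 1) / α := by
  rw [one_lt_div hα0]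
  have := Real.add_one_lt_exp (x := α - 1) (by linarith)
  linarith

theorem one_lt_radius {α : ℝ} (hα0 : 0 < α) (hα1 : α < 1) {b : ℕ} (hb : 1 ≤ b) :
    1 < radius α b :=
  one_lt_pow₀ (one_lt_exp_sub_one_div hα0 hα1) (by omega)

/-- This makes `q = R`, `z = 1/α` an admissible pair for optional stopping. -/
theorem radius_mul_exp {α : ℝ} (hα0 : 0 < α) (b : ℕ) :
    radius α b * Real.exp (α * b * (1 / α - 1)) = (1 / α) ^ b := by
  rw [radius, show α * b * (1 / α - 1) = b * (1 - α) by field_simp, Real.exp_nat_mul, ← mul_pow,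
    div_mul_eq_mul_div, ← Real.exp_add]
  simp

theorem pairwise_disjoint_exit {Ω : Type*} (b : ℕ) (X : ℕ → Ω → ℕ) :
    Pairwise (Function.onFun Disjoint fun n => {ω : Ω | (X · ω) ∈ exitSeq b n}) := by
  intro m n hmn
  refine Set.disjoint_left.2 fun ω hm hn => hmn ?_
  have := (blockLength_eq_of_mem_exitSeq hm).symm.trans (blockLength_eq_of_mem_exitSeq hn)
  omega

namespace IsPoissonTable

variable {Ω : Type*} [MeasurableSpace Ω] {μ : Measure Ω} [IsProbabilityMeasure μ] {α : ℝ} {b : ℕ}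
  {X : ℕ → Ω → ℕ}

theorem sum_radius_pow_mul_setIntegral_exit (h : IsPoissonTable μ α b X) (hα0 : 0 < α) (n : ℕ) :
    ∑ k ∈ Finset.range n, radius α b ^ (k + 1) *
        ∫ ω in {ω | (X · ω) ∈ exitSeq b k}, (1 / α) ^ profile b (X · ω) (k + 1) ∂μ =
      (1 / α) ^ b * (1 - radius α b ^ n *
        ∫ ω in {ω | (X · ω) ∈ fullSeq b n}, (1 / α) ^ overflow b (X · ω) n ∂μ) := by
  have := h.sum_pow_mul_setIntegral_exit hα0 (q := (radius α b : ℂ)) (z := ((1 / α : ℝ) : ℂ))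
    (by exact_mod_cast radius_mul_exp hα0 b) n
  simp only [← Complex.ofReal_pow, integral_complex_ofReal] at this
  exact_mod_cast this

theorem integrable_real_pow_overflow (h : IsPoissonTable μ α b X) (n : ℕ) (s : ℝ) :
    Integrable (fun ω => s ^ overflow b (X · ω) n) μ := by
  have := (h.integrable_pow_overflow n (s : ℂ)).re
  simpa [← Complex.ofReal_pow] using this

theorem integrable_real_pow_profile (h : IsPoissonTable μ α b X) (n : ℕ) (s : ℝ) :
    Integrable (fun ω => s ^ profile b (X · ω) (n + 1)) μ := by
  have := (h.integrable_pow_profile n (s : ℂ)).re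
  simpa [← Complex.ofReal_pow] using this

/-- The stopped sum at `(R, 1/α)` is nonnegative, so its remainder cannot exceed `1`; no limit is
needed. -/
theorem radius_pow_mul_setIntegral_le_one (h : IsPoissonTable μ α b X) (hα0 : 0 < α) (n : ℕ) :
    radius α b ^ n *
      ∫ ω in {ω | (X · ω) ∈ fullSeq b n}, (1 / α) ^ overflow b (X · ω) n ∂μ ≤ 1 := by
  have h1 := h.sum_radius_pow_mul_setIntegral_exit hα0 n
  have h2 : 0 ≤ ∑ k ∈ Finset.range n, radius α b ^ (k + 1) *
      ∫ ω in {ω | (X · ω) ∈ exitSeq b k}, (1 / α) ^ profile b (X · ω) (k + 1) ∂μ :=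
    Finset.sum_nonneg fun k _ => mul_nonneg (by unfold radius; positivity)
      (integral_nonneg fun ω => by positivity)
  rw [h1] at h2
  have := (mul_nonneg_iff_of_pos_left (by positivity)).1 h2
  linarith

theorem measure_le_setIntegral_pow (hα0 : 0 < α) (hα1 : α < 1) {S : Set Ω}
    {f : Ω → ℕ} (hf : Integrable (fun ω => (1 / α) ^ f ω) μ) :
    μ.real S ≤ ∫ ω in S, (1 / α) ^ f ω ∂μ := by
  have h1 : 1 ≤ 1 / α := by rw [le_div_iff₀ hα0]; linarith
  calc μ.real S = ∫ _ in S, (1 : ℝ) ∂μ := by simp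
    _ ≤ _ := integral_mono (integrable_const _) hf.integrableOn fun ω => one_le_pow₀ h1

/-- As `1/α ≥ 1`, each term is at most its counterpart in the stopped sum at `(R, 1/α)`, whose
partial sums are at most `(1/α) ^ b`. The endpoint `R` itself is thus included. -/
theorem summable_radius_pow_mul_exit (h : IsPoissonTable μ α b X) (hα0 : 0 < α) (hα1 : α < 1) :
    Summable fun k => radius α b ^ (k + 1) * μ.real {ω | (X · ω) ∈ exitSeq b k} := by
  have hR : 0 ≤ radius α b := by unfold radius; positivity
  refine summable_of_sum_range_le (c := (1 / α) ^ b) (fun k => by positivity) fun n => ?_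
  calc _ ≤ ∑ k ∈ Finset.range n, radius α b ^ (k + 1) *
        ∫ ω in {ω | (X · ω) ∈ exitSeq b k}, (1 / α) ^ profile b (X · ω) (k + 1) ∂μ := by
        gcongr with k
        exact measure_le_setIntegral_pow hα0 hα1 (h.integrable_real_pow_profile k _)
    _ ≤ (1 / α) ^ b * 1 := by
        rw [h.sum_radius_pow_mul_setIntegral_exit hα0]
        gcongr
        have : 0 ≤ ∫ ω in {ω | (X · ω) ∈ fullSeq b n}, (1 / α) ^ overflow b (X · ω) n ∂μ :=
          integral_nonneg fun ω => by positivity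
        have := mul_nonneg (pow_nonneg hR n) this
        linarith
    _ = _ := mul_one _

/-- The first block is almost surely finite. -/
theorem ae_exists_exit (h : IsPoissonTable μ α b X) (hα0 : 0 < α) (hα1 : α < 1) (hb : 1 ≤ b) :
    ∀ᵐ ω ∂μ, ∃ n, (X · ω) ∈ exitSeq b n := by
  have hR := one_lt_radius hα0 hα1 hb
  -- If no bucket ever has room, buckets `1, …, n` are full for every `n`, an event of probability
  -- at most `R⁻ⁿ`.
  have hle : ∀ n, μ.real {ω | ¬∃ n, (X · ω) ∈ exitSeq b n} ≤ (radius α b)⁻¹ ^ n := by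
    intro n
    rw [inv_pow, ← one_div, le_div_iff₀ (by positivity), mul_comm]
    refine le_trans (mul_le_mul_of_nonneg_left ?_ (by positivity))
      (h.radius_pow_mul_setIntegral_le_one hα0 n)
    refine le_trans (measureReal_mono ?_)
      (measure_le_setIntegral_pow hα0 hα1 (h.integrable_real_pow_overflow n _))
    intro ω hω i _
    by_contra! hlt
    exact hω (exists_mem_exitSeq hlt)
  have hlim := tendsto_pow_atTop_nhds_zero_of_lt_one (inv_nonneg.2 (zero_le_one.trans hR.le))
    (inv_lt_one_of_one_lt₀ hR)
  have h0 := le_antisymm (ge_of_tendsto' hlim hle) measureReal_nonneg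
  rw [measureReal_eq_zero_iff] at h0
  exact h0

theorem iUnion_exit_ae_eq (h : IsPoissonTable μ α b X) (hα0 : 0 < α) (hα1 : α < 1) (hb : 1 ≤ b) :
    (⋃ n, {ω | (X · ω) ∈ exitSeq b n} : Set Ω) =ᵐ[μ] Set.univ := by
  rw [eventuallyEq_univ]
  filter_upwards [h.ae_exists_exit hα0 hα1 hb] with ω hω
  simpa using hω

/-- The value of `H_B` is below `b`, so that any function of it is bounded. -/
theorem integrable_blockLength_mul (h : IsPoissonTable μ α b X) (hα0 : 0 < α) (hα1 : α < 1)
    (hb : 1 ≤ b) {q : ℂ} (hq : ‖q‖ ≤ radius α b) (g : ℕ → ℂ) :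
    Integrable (fun ω => q ^ blockLength b (X · ω) *
      g (profile b (X · ω) (blockLength b (X · ω)))) μ := by
  have hcongr : ∀ k, ∀ ω ∈ {ω | (X · ω) ∈ exitSeq b k}, q ^ (k + 1) *
      g (profile b (X · ω) (k + 1)) = q ^ blockLength b (X · ω) *
      g (profile b (X · ω) (blockLength b (X · ω))) := fun k ω hω => by
    rw [blockLength_eq_of_mem_exitSeq hω]
  have hbound : ∀ k, ∀ ω ∈ {ω | (X · ω) ∈ exitSeq b k},
      ‖q ^ (k + 1) * g (profile b (X · ω) (k + 1))‖ ≤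
        (∑ j ∈ Finset.range b, ‖g j‖) * radius α b ^ (k + 1) := fun k ω hω => by
    rw [norm_mul, norm_pow, mul_comm]
    have h1 : ‖g (profile b (X · ω) (k + 1))‖ ≤ ∑ j ∈ Finset.range b, ‖g j‖ :=
      Finset.single_le_sum (f := fun j => ‖g j‖) (fun _ _ => norm_nonneg _)
        (Finset.mem_range.2 hω.2)
    gcongr
  have hint : ∀ k, IntegrableOn (fun ω => q ^ blockLength b (X · ω) *
      g (profile b (X · ω) (blockLength b (X · ω)))) {ω | (X · ω) ∈ exitSeq b k} μ := fun k =>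
    (Measure.integrableOn_of_bounded (measure_ne_top _ _)
      (((Measurable.of_discrete (f := g)).comp
        (h.measurable_profile (k + 1))).const_mul (q ^ (k + 1))).aestronglyMeasurable
      (ae_restrict_of_forall_mem (h.measurableSet_exit k) (hbound k))).congr_fun
      (hcongr k) (h.measurableSet_exit k)
  rw [← integrableOn_univ]
  refine IntegrableOn.congr_set_ae ?_ (h.iUnion_exit_ae_eq hα0 hα1 hb).symm
  refine integrableOn_iUnion_of_summable_integral_norm hint ?_
  refine Summable.of_nonneg_of_le (fun k => integral_nonneg fun ω => norm_nonneg _) (fun k => ?_)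
    ((h.summable_radius_pow_mul_exit hα0 hα1).mul_left (∑ j ∈ Finset.range b, ‖g j‖))
  calc _ ≤ ∫ _ in {ω | (X · ω) ∈ exitSeq b k},
          (∑ j ∈ Finset.range b, ‖g j‖) * radius α b ^ (k + 1) ∂μ := by
        refine setIntegral_mono_on (hint k).norm (integrable_const _) (h.measurableSet_exit k)
          fun ω hω => ?_
        rw [← hcongr k ω hω]
        exact hbound k ω hω
    _ = _ := by
        simp
        ring

theorem hasSum_integral_pow_blockLength (h : IsPoissonTable μ α b X) (hα0 : 0 < α) (hα1 : α < 1)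
    (hb : 1 ≤ b) {q : ℂ} (hq : ‖q‖ ≤ radius α b) (t : ℂ) :
    HasSum (fun k => q ^ (k + 1) *
      ∫ ω in {ω | (X · ω) ∈ exitSeq b k}, t ^ profile b (X · ω) (k + 1) ∂μ)
      (∫ ω, q ^ blockLength b (X · ω) * t ^ profile b (X · ω) (blockLength b (X · ω)) ∂μ) := by
  have hs := hasSum_integral_iUnion h.measurableSet_exit (pairwise_disjoint_exit b X)
    (h.integrable_blockLength_mul hα0 hα1 hb hq (t ^ ·)).integrableOn
  rw [setIntegral_congr_set (h.iUnion_exit_ae_eq hα0 hα1 hb), setIntegral_univ] at hs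
  convert! hs using 1
  funext k
  rw [← integral_const_mul]
  refine setIntegral_congr_fun (h.measurableSet_exit k) fun ω hω => ?_
  rw [blockLength_eq_of_mem_exitSeq hω]

theorem norm_setIntegral_pow_overflow_le (h : IsPoissonTable μ α b X) {z : ℂ}
    (hz : ‖z‖ ≤ 1 / α) (n : ℕ) :
    ‖∫ ω in {ω | (X · ω) ∈ fullSeq b n}, z ^ overflow b (X · ω) n ∂μ‖ ≤
      ∫ ω in {ω | (X · ω) ∈ fullSeq b n}, (1 / α) ^ overflow b (X · ω) n ∂μ := by
  refine norm_integral_le_of_norm_le (h.integrable_real_pow_overflow n _).integrableOn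
    (ae_of_all _ fun ω => ?_)
  rw [norm_pow]
  gcongr

/-- The optional stopping identity at the time `B`, in the open disc. -/
theorem integral_pow_blockLength_of_lt (h : IsPoissonTable μ α b X) (hα0 : 0 < α) (hα1 : α < 1)
    (hb : 1 ≤ b) {q z : ℂ} (hq : ‖q‖ < radius α b) (hz : ‖z‖ ≤ 1 / α)
    (hqz : q * Complex.exp (α * b * (z - 1)) = z ^ b) :
    ∫ ω, q ^ blockLength b (X · ω) * z ^ profile b (X · ω) (blockLength b (X · ω)) ∂μ = z ^ b := by
  have hR : 0 < radius α b := zero_lt_one.trans (one_lt_radius hα0 hα1 hb)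
  have hs := (h.hasSum_integral_pow_blockLength hα0 hα1 hb hq.le z).tendsto_sum_nat
  simp_rw [h.sum_pow_mul_setIntegral_exit hα0 hqz] at hs
  refine tendsto_nhds_unique hs ?_
  have hzero : Tendsto (fun n => q ^ n *
      ∫ ω in {ω | (X · ω) ∈ fullSeq b n}, z ^ overflow b (X · ω) n ∂μ) atTop (𝓝 0) := by
    -- The remainder at `|z| ≤ 1/α` is at most `(|q| / R) ^ n`; strictness of `|q| < R` is used
    -- here.
    refine squeeze_zero_norm (a := fun n => (‖q‖ / radius α b) ^ n) (fun n => ?_)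
      (tendsto_pow_atTop_nhds_zero_of_lt_one (by positivity) ((div_lt_one hR).2 hq))
    rw [norm_mul, norm_pow, div_pow, div_eq_mul_inv]
    gcongr
    refine (h.norm_setIntegral_pow_overflow_le hz n).trans ?_
    rw [← one_div, le_div_iff₀ (by positivity), mul_comm]
    exact h.radius_pow_mul_setIntegral_le_one hα0 n
  simpa using (hzero.const_sub 1).const_mul (z ^ b)

end IsPoissonTable
end PoissonHashing

namespace PoissonHashing

/-! ### The roots `ζ_ℓ`, the polynomial identity, and the boundary circle. -/

open MeasureTheory ProbabilityTheory Filter Topology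

section Zeta

variable {α : ℝ} {b : ℕ} {q r : ℂ}

theorem norm_zeta_le (hα : 0 < α) (hb : 1 ≤ b) (hq : ‖q‖ ≤ radius α b) (hr : r ^ b = q) (l : ℕ) :
    ‖zeta α b r l‖ ≤ 1 / α := by
  rw [zeta, norm_div, Complex.norm_real, Real.norm_of_nonneg hα.le]
  gcongr
  exact norm_treeFunction_le_one (norm_zeta_arg_le hα hb hq hr l)

/-- The functional equation `T = z e^T`, rescaled by `T = α ζ`. -/
theorem zeta_eq (hα : 0 < α) (hb : 1 ≤ b) (hq : ‖q‖ ≤ radius α b) (hr : r ^ b = q) (l : ℕ) :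
    zeta α b r l = Complex.exp (2 * Real.pi * Complex.I / b) ^ l * r *
      Complex.exp (α * (zeta α b r l - 1)) := by
  have hα' : (α : ℂ) ≠ 0 := by exact_mod_cast hα.ne'
  have h := treeFunction_mul_exp_neg_self (norm_zeta_arg_le hα hb hq hr l)
  have hT : treeFunction (Complex.exp (2 * Real.pi * Complex.I / b) ^ l *
      (α * Complex.exp (-α)) * r) = α * zeta α b r l := by
    rw [zeta]
    field_simp
  rw [hT, Complex.exp_neg, ← div_eq_mul_inv, div_eq_iff (Complex.exp_ne_zero _)] at h
  rw [← mul_right_inj' hα', h, mul_sub, sub_eq_neg_add, Complex.exp_add, mul_one]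
  ring

theorem exp_two_pi_I_div_pow (hb : 1 ≤ b) : Complex.exp (2 * Real.pi * Complex.I / b) ^ b = 1 :=
  (Complex.isPrimitiveRoot_exp b (by omega)).pow_eq_one

/-- The `b`-th power of `zeta_eq` removes the root of unity, so every `ζ_ℓ` is admissible for the
same `q`. -/
theorem mul_exp_zeta_eq_pow (hα : 0 < α) (hb : 1 ≤ b) (hq : ‖q‖ ≤ radius α b) (hr : r ^ b = q)
    (l : ℕ) : q * Complex.exp (α * b * (zeta α b r l - 1)) = zeta α b r l ^ b := by
  conv_rhs => rw [zeta_eq hα hb hq hr l]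
  rw [mul_pow, mul_pow, hr, ← pow_mul, mul_comm l b, pow_mul, exp_two_pi_I_div_pow hb, one_pow,
    one_mul, ← Complex.exp_nat_mul]
  ring_nf

/-- By `zeta_eq`, the value `ζ_ℓ` determines `ω ^ ℓ * r`, hence `ω ^ ℓ` when `r ≠ 0`, and `ω` is a
primitive `b`-th root of unity. -/
theorem zeta_injOn (hα : 0 < α) (hb : 1 ≤ b) (hq : ‖q‖ ≤ radius α b) (hr : r ^ b = q)
    (hr0 : r ≠ 0) : Set.InjOn (zeta α b r) (Finset.range b) := by
  intro l hl l' hl' heq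
  have h1 := (zeta_eq hα hb hq hr l).symm.trans (heq.trans (zeta_eq hα hb hq hr l'))
  rw [heq] at h1
  have h2 := mul_right_cancel₀ hr0 (mul_right_cancel₀ (Complex.exp_ne_zero _) h1)
  exact (Complex.isPrimitiveRoot_exp b (by omega)).pow_inj (by simpa using hl)
    (by simpa using hl') h2

theorem zeta_zero (l : ℕ) : zeta α b 0 l = 0 := by
  simp [zeta, treeFunction_zero]

theorem tendsto_zeta (hα : 0 < α) (hb : 1 ≤ b) (hq : ‖q‖ ≤ radius α b) (hr : r ^ b = q)
    {u : ℕ → ℝ} (hu0 : ∀ n, 0 ≤ u n) (hu1 : ∀ n, u n ≤ 1) (hu : Tendsto u atTop (𝓝 1)) (l : ℕ) :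
    Tendsto (fun n => zeta α b (u n * r) l) atTop (𝓝 (zeta α b r l)) := by
  have harg := norm_zeta_arg_le hα hb hq hr l
  refine Tendsto.div_const ?_ _
  refine (continuousOn_treeFunction _ (by simpa using harg)).tendsto.comp
    (tendsto_nhdsWithin_iff.2 ⟨?_, Eventually.of_forall fun n => ?_⟩)
  · have hu' : Tendsto (fun n => (u n : ℂ)) atTop (𝓝 1) := by
      exact_mod_cast (Complex.continuous_ofReal.tendsto 1).comp hu
    simpa using (hu'.mul_const r).const_mul
      (Complex.exp (2 * Real.pi * Complex.I / b) ^ l * (α * Complex.exp (-α)))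
  · rw [mem_closedBall_zero_iff, mul_left_comm, norm_mul, Complex.norm_real,
      Real.norm_of_nonneg (hu0 n)]
    exact (mul_le_of_le_one_left (norm_nonneg _) (hu1 n)).trans harg

end Zeta

/-- A monic polynomial of degree `b` is the product of the linear factors of `b` distinct roots. -/
theorem pow_sub_sum_eq_prod {b : ℕ} {f ζ : ℕ → ℂ} (hinj : Set.InjOn ζ (Finset.range b))
    (hroot : ∀ l ∈ Finset.range b, ∑ k ∈ Finset.range b, ζ l ^ k * f k = ζ l ^ b) (t : ℂ) :
    t ^ b - ∑ k ∈ Finset.range b, t ^ k * f k = ∏ l ∈ Finset.range b, (t - ζ l) := by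
  let S : Polynomial ℂ := ∑ k ∈ Finset.range b, Polynomial.C (f k) * Polynomial.X ^ k
  let P : Polynomial ℂ := ∏ l ∈ Finset.range b, (Polynomial.X - Polynomial.C (ζ l))
  have hS : ∀ x, S.eval x = ∑ k ∈ Finset.range b, x ^ k * f k := fun x => by
    simp only [S, Polynomial.eval_finsetSum, Polynomial.eval_mul, Polynomial.eval_C,
      Polynomial.eval_pow, Polynomial.eval_X]
    exact Finset.sum_congr rfl fun k _ => mul_comm _ _
  have hP : ∀ x, P.eval x = ∏ l ∈ Finset.range b, (x - ζ l) := fun x => by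
    simp [P, Polynomial.eval_prod]
  have hSdeg : S.degree < b := by
    refine (Polynomial.degree_sum_le _ _).trans_lt
      ((Finset.sup_lt_iff (WithBot.bot_lt_coe b)).2 fun k hk => ?_)
    exact (Polynomial.degree_C_mul_X_pow_le _ _).trans_lt
      (Nat.cast_lt.2 (Finset.mem_range.1 hk))
  have hPmonic : P.Monic := Polynomial.monic_prod_of_monic _ _ fun l _ => Polynomial.monic_X_sub_C _
  have hPdeg : P.degree = b := by simp [P, Polynomial.degree_prod]
  have hXdeg : (Polynomial.X ^ b - S).degree = (b : WithBot ℕ) := by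
    rw [Polynomial.degree_sub_eq_left_of_degree_lt] <;> simp [hSdeg]
  have hXmonic : (Polynomial.X ^ b - S).Monic := 
    (Polynomial.monic_X_pow b).sub_of_left (by simpa using hSdeg)
  -- Both sides are monic of degree `b`, so agreement at the `b` distinct points `ζ l` suffices.
  have heq : Polynomial.X ^ b - S = P := by
    refine Polynomial.eq_of_degree_le_of_eval_index_eq (Finset.range b) hinj ?_ ?_ ?_ ?_
    · simp [hXdeg]
    · rw [hXdeg, hPdeg]
    · rw [hXmonic.leadingCoeff, hPmonic.leadingCoeff]
    · intro l hl
      rw [hP, Finset.prod_eq_zero hl (sub_self _), Polynomial.eval_sub, hS, hroot l hl]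
      simp
  rw [← hP, ← heq, Polynomial.eval_sub, hS]
  simp

namespace IsPoissonTable

variable {Ω : Type*} [MeasurableSpace Ω] {μ : Measure Ω} [IsProbabilityMeasure μ] {α : ℝ} {b : ℕ}
  {X : ℕ → Ω → ℕ}

/-- Almost surely `H_B < b`, so the transform is a polynomial in `t` with coefficients `E (q ^ B;
H_B = k)`, `k < b`. -/
theorem integral_pow_blockLength_eq_sum (h : IsPoissonTable μ α b X) (hα0 : 0 < α) (hα1 : α < 1)
    (hb : 1 ≤ b) {q : ℂ} (hq : ‖q‖ ≤ radius α b) (t : ℂ) :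
    ∫ ω, q ^ blockLength b (X · ω) * t ^ profile b (X · ω) (blockLength b (X · ω)) ∂μ =
      ∑ k ∈ Finset.range b, t ^ k * ∫ ω, q ^ blockLength b (X · ω) *
        (if profile b (X · ω) (blockLength b (X · ω)) = k then 1 else 0) ∂μ := by
  simp_rw [← integral_const_mul]
  rw [← integral_finsetSum _ fun k _ =>
    (h.integrable_blockLength_mul hα0 hα1 hb hq fun j => if j = k then 1 else 0).const_mul (t ^ k)]
  refine integral_congr_ae ?_
  filter_upwards [h.ae_exists_exit hα0 hα1 hb] with ω ⟨n, hn⟩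
  have hlt : profile b (X · ω) (blockLength b (X · ω)) < b := by
    rw [blockLength_eq_of_mem_exitSeq hn]
    exact hn.2
  rw [Finset.sum_eq_single (profile b (X · ω) (blockLength b (X · ω)))]
  · simp [mul_comm]
  · intro k _ hk
    simp [hk.symm]
  · intro hk
    exact absurd (Finset.mem_range.2 hlt) hk

theorem integral_pow_blockLength_eq_prod_of_lt (h : IsPoissonTable μ α b X) (hα0 : 0 < α)
    (hα1 : α < 1) (hb : 1 ≤ b) {q r : ℂ} (hq : ‖q‖ < radius α b) (hr : r ^ b = q) (hr0 : r ≠ 0)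
    (t : ℂ) :
    ∫ ω, q ^ blockLength b (X · ω) * t ^ profile b (X · ω) (blockLength b (X · ω)) ∂μ =
      t ^ b - ∏ l ∈ Finset.range b, (t - zeta α b r l) := by
  rw [← pow_sub_sum_eq_prod (zeta_injOn hα0 hb hq.le hr hr0) (fun l _ => ?_) t, sub_sub_cancel]
  · exact h.integral_pow_blockLength_eq_sum hα0 hα1 hb hq.le t
  · rw [← h.integral_pow_blockLength_eq_sum hα0 hα1 hb hq.le]
    exact h.integral_pow_blockLength_of_lt hα0 hα1 hb hq (norm_zeta_le hα0 hb hq.le hr l)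
      (mul_exp_zeta_eq_pow hα0 hb hq.le hr l)

/-- The joint generating function of `B` and `H_B`. -/
theorem integral_pow_blockLength_eq_prod (h : IsPoissonTable μ α b X) (hα0 : 0 < α)
    (hα1 : α < 1) (hb : 1 ≤ b) {q r : ℂ} (hq : ‖q‖ ≤ radius α b) (hr : r ^ b = q) (t : ℂ) :
    ∫ ω, q ^ blockLength b (X · ω) * t ^ profile b (X · ω) (blockLength b (X · ω)) ∂μ =
      t ^ b - ∏ l ∈ Finset.range b, (t - zeta α b r l) := by
  -- At `r = 0` all `ζ_ℓ` coincide and interpolation is unavailable, but both sides vanish because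
  -- `B ≥ 1` almost surely.
  rcases eq_or_ne r 0 with rfl | hr0
  · have hq0 : q = 0 := by rw [← hr, zero_pow (by omega)]
    subst hq0
    simp only [zeta_zero, sub_zero, Finset.prod_const, Finset.card_range, sub_self]
    refine integral_eq_zero_of_ae ?_
    filter_upwards [h.ae_exists_exit hα0 hα1 hb] with ω ⟨n, hn⟩
    simp [blockLength_eq_of_mem_exitSeq hn]
  -- The shift by `2` keeps `u 0` positive, so the root `u n * r` is never zero while `u n ^ b * q`
  -- stays strictly inside the disc.
  let u : ℕ → ℝ := fun n => 1 - 1 / (n + 2)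
  have hpos : ∀ n : ℕ, (1 : ℝ) / (n + 2) < 1 := fun n => by
    rw [div_lt_one (by positivity)]
    linarith [(Nat.cast_nonneg n : (0 : ℝ) ≤ n)]
  have hu0 : ∀ n, 0 < u n := fun n => sub_pos.2 (hpos n)
  have hu1 : ∀ n, u n < 1 := fun n => sub_lt_self _ (by positivity)
  have hu : Tendsto u atTop (𝓝 1) := by
    have h1 := (tendsto_one_div_add_atTop_nhds_zero_nat (𝕜 := ℝ)).comp (tendsto_add_atTop_nat 1)
    have h2 := h1.const_sub 1
    rw [sub_zero] at h2
    refine h2.congr fun n => ?_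
    simp only [u, Function.comp_apply]
    push_cast
    ring
  have hqn : ∀ n, ‖(u n : ℂ) ^ b * q‖ = u n ^ b * ‖q‖ := fun n => by
    rw [norm_mul, norm_pow, Complex.norm_real, Real.norm_of_nonneg (hu0 n).le]
  have hqle : ∀ n, ‖(u n : ℂ) ^ b * q‖ ≤ ‖q‖ := fun n => by
    rw [hqn]
    exact mul_le_of_le_one_left (norm_nonneg _) (pow_le_one₀ (hu0 n).le (hu1 n).le)
  have hqlt : ∀ n, ‖(u n : ℂ) ^ b * q‖ < radius α b := fun n => by
    refine lt_of_lt_of_le ?_ hq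
    rw [hqn]
    exact mul_lt_of_lt_one_left (norm_pos_iff.2 (hr ▸ pow_ne_zero b hr0))
      (pow_lt_one₀ (hu0 n).le (hu1 n) (by omega))
  have hlim : Tendsto (fun n => ∫ ω, ((u n : ℂ) ^ b * q) ^ blockLength b (X · ω) *
      t ^ profile b (X · ω) (blockLength b (X · ω)) ∂μ) atTop
      (𝓝 (∫ ω, q ^ blockLength b (X · ω) *
        t ^ profile b (X · ω) (blockLength b (X · ω)) ∂μ)) := by
    -- The dominating function is the norm of the integrand at `q` itself, integrable even when `|q|
    -- = R`.
    refine tendsto_integral_of_dominated_convergence _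
      (fun n => (h.integrable_blockLength_mul hα0 hα1 hb (hqlt n).le (t ^ ·)).aestronglyMeasurable)
      (h.integrable_blockLength_mul hα0 hα1 hb hq (t ^ ·)).norm
      (fun n => ae_of_all _ fun ω => ?_) (ae_of_all _ fun ω => ?_)
    · rw [norm_mul, norm_mul, norm_pow, norm_pow q]
      gcongr
      exact hqle n
    · have hu' : Tendsto (fun n => (u n : ℂ)) atTop (𝓝 1) := by
        exact_mod_cast (Complex.continuous_ofReal.tendsto 1).comp hu
      simpa using (((hu'.pow b).mul_const q).pow _).mul_const _
  refine tendsto_nhds_unique hlim ?_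
  have hprod := (tendsto_finsetProd (Finset.range b) fun l _ =>
    (tendsto_zeta hα0 hb hq hr (fun n => (hu0 n).le) (fun n => (hu1 n).le) hu l).const_sub t).const_sub
      (t ^ b)
  refine hprod.congr fun n => ?_
  exact (h.integral_pow_blockLength_eq_prod_of_lt hα0 hα1 hb (hqlt n) (by rw [mul_pow, hr])
    (mul_ne_zero (by exact_mod_cast (hu0 n).ne') hr0) t).symm

end IsPoissonTable
end PoissonHashing

theorem mainTheorem3 {Ω : Type*} [MeasurableSpace Ω] (μ : MeasureTheory.Measure Ω)
    [MeasureTheory.IsProbabilityMeasure μ] (α : ℝ) (hα0 : 0 < α) (hα1 : α < 1)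
    (b : ℕ) (hb : 1 ≤ b) (X : ℕ → Ω → ℕ)
    (hXmeas : ∀ i : ℕ, 1 ≤ i → Measurable (X i))
    (hXlaw : ∀ i : ℕ, 1 ≤ i →
      MeasureTheory.Measure.map (X i) μ = ProbabilityTheory.poissonMeasure (Real.toNNReal (α * b)))
    (hXindep : ProbabilityTheory.iIndepFun (fun i : ℕ => X (i + 1)) μ) :
    let x : Ω → ℕ → ℕ := fun ω i => X i ω
    let B : Ω → ℕ := fun ω => PoissonHashing.blockLength b (x ω)
    let Y : Ω → ℕ := fun ω => PoissonHashing.stored b (x ω) (B ω)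
    let H : Ω → ℕ := fun ω => PoissonHashing.profile b (x ω) (B ω)
    let R : ℝ := PoissonHashing.radius α b
    (∀ᵐ ω ∂μ, ∃ i : ℕ, 1 ≤ i ∧ PoissonHashing.stored b (x ω) i < b) ∧
    1 < R ∧
    (∀ q r : ℂ, ‖q‖ ≤ R → r ^ b = q →
      MeasureTheory.Integrable (fun ω => q ^ B ω) μ ∧
      ∫ ω, q ^ B ω ∂μ = 1 - ∏ l ∈ Finset.range b, (1 - PoissonHashing.zeta α b r l)) ∧
    (∀ q r t : ℂ, ‖q‖ ≤ R → r ^ b = q →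
      MeasureTheory.Integrable (fun ω => q ^ B ω * t ^ Y ω) μ ∧
      MeasureTheory.Integrable (fun ω => q ^ B ω * t ^ H ω) μ ∧
      ∫ ω, q ^ B ω * t ^ Y ω ∂μ = ∫ ω, q ^ B ω * t ^ H ω ∂μ ∧
      ∫ ω, q ^ B ω * t ^ H ω ∂μ
        = t ^ b - ∏ l ∈ Finset.range b, (t - PoissonHashing.zeta α b r l)) := by 
  intro x B Y H R
  have h : PoissonHashing.IsPoissonTable μ α b X :=
    ⟨fun i => hXmeas _ (by omega), fun i => hXlaw _ (by omega), hXindep⟩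
  have hae := h.ae_exists_exit hα0 hα1 hb
  have hint : ∀ q t : ℂ, ‖q‖ ≤ R → MeasureTheory.Integrable (fun ω => q ^ B ω * t ^ H ω) μ :=
    fun q t hq => h.integrable_blockLength_mul hα0 hα1 hb hq (t ^ ·)
  have hval : ∀ q r t : ℂ, ‖q‖ ≤ R → r ^ b = q → ∫ ω, q ^ B ω * t ^ H ω ∂μ
      = t ^ b - ∏ l ∈ Finset.range b, (t - PoissonHashing.zeta α b r l) :=
    fun q r t hq hr => h.integral_pow_blockLength_eq_prod hα0 hα1 hb hq hr t
  refine ⟨?_, PoissonHashing.one_lt_radius hα0 hα1 hb, fun q r hq hr => ?_, fun q r t hq hr => ?_⟩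
  · filter_upwards [hae] with ω ⟨n, hn⟩
    exact ⟨n + 1, by omega, PoissonHashing.stored_lt_iff.2 hn.2⟩
  · exact ⟨by simpa using hint q 1 hq, by simpa using hval q r 1 hq hr⟩
  -- Bucket `B` is not full, so the truncation at `b` in `Y` has no effect.
  · have hYH : (fun ω => q ^ B ω * t ^ H ω) =ᵐ[μ] fun ω => q ^ B ω * t ^ Y ω := by
      filter_upwards [hae] with ω ⟨n, hn⟩
      have hlt : H ω < b := by
        simp only [H, B, x, PoissonHashing.blockLength_eq_of_mem_exitSeq hn]
        exact hn.2
      rw [show Y ω = H ω from min_eq_left hlt.le]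
    exact ⟨(hint q t hq).congr hYH, hint q t hq, (MeasureTheory.integral_congr_ae hYH).symm,
      hval q r t hq hr⟩
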